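/- Fix a dimension $d\ge 1$. For a finite set $P\subset[0,1]^d$ with at least two points let $h(P)=\sup_{x\in[0,1]^d}\min_{y\in P}\|x-y\|_2$, $q(P)=\tfrac12\min_{x\ne y\in P}\|x-y\|_2$ and $\rho(P)=h(P)/q(P)$. A family $(P_i)_{i\ge1}$ of such sets with $|P_i|=N_i$ is called quasi-uniform if there are constants $c>1$ and $C>0$, independent of $i$, such that $N_i<N_{i+1}\le cN_i$ and $\rho(P_i)\le C$ for all $i$. For a prime $N$ and $a\in\{1,\dots,N-1\}$ let $z=(z_1,\dots,z_d)=(1,a,\dots,a^{d-1})\bmod N$, let $P_{N,a}=\{(\{nz_1/N\},\dots,\{nz_d/N\}):0\le n<N\}$ be the Korobov lattice point set ($\{\cdot\}$ is the fractional part), let $\Lambda_{N,a}=\frac1N z\mathbb Z+\mathbb Z^d$, and let $\Lambda_{N,a}^\perp=\{y\in\mathbb R^d: x\cdot y\in\mathbb Z\ \text{for all } x\in\Lambda_{N,a}\}$. Let $\lambda_1(\Lambda)$ be the first successive minimum of a lattice $\Lambda$ with respect to the Euclidean unit ball, that is, the length of its shortest non-zero vector. Given a score $s(a)$ for each $a\in\{1,\dots,N-1\}$,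 the exhaustive search starts with $s_{\max}=0$, $a^*=1$, runs through $a=1,\dots,N-1$ in this order, replaces $(s_{\max},a^*)$ by $(s(a),a)$ whenever $s(a)>s_{\max}$, and finally returns $a^*$. Let $N_i$ be the $i$-th smallest prime number. (i) If $a_i$ is returned by the exhaustive search for $N=N_i$ with the score $s(a)=\lambda_1(\Lambda_{N_i,a})\lambda_1(\Lambda_{N_i,a}^\perp)$, then $a_i\in\{1,\dots,N_i-1\}$ maximizes this score over $\{1,\dots,N_i-1\}$, and $(P_{N_i,a_i})_{i\ge1}$ is a quasi-uniform family of point sets. (ii) Let $1/4<\delta<1$, and for all $i$ and $a\in\{1,\dots,N_i-1\}$ take any LLL-reduced bases (with parameter $\delta$) of $\Lambda_{N_i,a}$ and of $\Lambda_{N_i,a}^\perp$. If $a_i$ is returned by the exhaustive search for $N=N_i$ with the score $s(a)=\|v_1\|_2\|v_1^\perp\|_2$, where $v_1$ and $v_1^\perp$ are shortest among the vectors of these two bases, then $a_i\in\{1,\dots,N_i-1\}$ and $(P_{N_i,a_i})_{i\ge1}$ is a quasi-uniform family of point sets. Here a basis $b_1,\dots,b_d$ with Gram–Schmidt vectors $b_k^*$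 and coefficients $\mu_{k,l}=\langle b_k,b_l^*\rangle/\|b_l^*\|_2^2$ is LLL-reduced with parameter $\delta$ if $|\mu_{k,l}|\le\frac12$ for $l<k$ and $\delta\|b_{k-1}^*\|_2^2\le\|b_k^*\|_2^2+\mu_{k,k-1}^2\|b_{k-1}^*\|_2^2$ for $2\le k\le d$. -/

import Mathlib

noncomputable section

/-- The unit cube `[0,1]^d` in Euclidean space. -/
def unitCube (d : ℕ) : Set (EuclideanSpace ℝ (Fin d)) :=
  {x | ∀ j, x j ∈ Set.Icc (0 : ℝ) 1}

/-- Covering radius (fill distance) of `P` with respect to the unit cube: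
`sup_{x ∈ [0,1]^d} min_{y ∈ P} ‖x - y‖₂`. -/
def coveringRadius {d : ℕ} (P : Set (EuclideanSpace ℝ (Fin d))) : ℝ :=
  sSup ((fun x => Metric.infDist x P) '' unitCube d)

/-- Separation radius of `P`: half of the smallest distance of two distinct points of `P`. -/
def separationRadius {d : ℕ} (P : Set (EuclideanSpace ℝ (Fin d))) : ℝ :=
  P.infsep / 2

/-- Mesh ratio `ρ(P) = h(P) / q(P)`, meaningful for sets with at least two points. -/
def meshRatio {d : ℕ} (P : Set (EuclideanSpace ℝ (Fin d))) : ℝ :=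
  coveringRadius P / separationRadius P

/-- `(P i)` is a quasi-uniform family of point sets in `[0,1]^d` with `|P i| = N i`.
The condition `2 ≤ N i` makes the mesh ratio meaningful. -/
structure IsQuasiUniformFamily {d : ℕ} (N : ℕ → ℕ)
    (P : ℕ → Set (EuclideanSpace ℝ (Fin d))) : Prop where
  subset_unitCube : ∀ i, P i ⊆ unitCube d
  two_le : ∀ i, 2 ≤ N i
  card_eq : ∀ i, (P i).ncard = N i
  strictMono : ∀ i, N i < N (i + 1)
  growth : ∃ c : ℝ, 1 < c ∧ ∀ i, (N (i + 1) : ℝ) ≤ c * (N i : ℝ)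
  meshRatio_le : ∃ C : ℝ, 0 < C ∧ ∀ i, meshRatio (P i) ≤ C

/-- The rank-1 lattice point set `{ ({n z_1 / N}, …, {n z_d / N}) : 0 ≤ n < N }`. -/
def rankOnePointSet {d : ℕ} (N : ℕ) (z : Fin d → ℕ) : Set (EuclideanSpace ℝ (Fin d)) :=
  {x | ∃ n : ℕ, n < N ∧ ∀ j, x j = Int.fract ((n : ℝ) * (z j : ℝ) / (N : ℝ))}

/-- The rank-1 lattice `(1/N) z ℤ + ℤ^d`. -/
def rankOneLattice {d : ℕ} (N : ℕ) (z : Fin d → ℕ) :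
    Submodule ℤ (EuclideanSpace ℝ (Fin d)) :=
  Submodule.span ℤ {WithLp.toLp 2 (fun j => (z j : ℝ) / (N : ℝ))} ⊔
    Submodule.span ℤ (Set.range (EuclideanSpace.basisFun (Fin d) ℝ))

/-- The Korobov generating vector `(1, a, a^2, …, a^{d-1}) mod N`. -/
def korobovVector (d N a : ℕ) : Fin d → ℕ := fun j => a ^ (j : ℕ) % N

/-- The Korobov lattice `Λ_a`. -/
def korobovLattice (d N a : ℕ) : Submodule ℤ (EuclideanSpace ℝ (Fin d)) :=
  rankOneLattice N (korobovVector d N a)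

/-- The Korobov lattice point set. -/
def korobovPointSet (d N a : ℕ) : Set (EuclideanSpace ℝ (Fin d)) :=
  rankOnePointSet N (korobovVector d N a)

/-- The dual lattice `{ y : x · y ∈ ℤ for all x ∈ Λ }`. -/
def dualLattice {d : ℕ} (L : Submodule ℤ (EuclideanSpace ℝ (Fin d))) :
    Submodule ℤ (EuclideanSpace ℝ (Fin d)) where
  carrier := {y | ∀ x ∈ L, ∃ k : ℤ, inner ℝ x y = (k : ℝ)}
  zero_mem' := fun x _ => ⟨0, by simp⟩
  add_mem' := by
    intro y z hy hz x hx
    obtain ⟨k, hk⟩ := hy x hx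
    obtain ⟨l, hl⟩ := hz x hx
    exact ⟨k + l, by rw [inner_add_right, hk, hl]; push_cast; rfl⟩
  smul_mem' := by
    intro c y hy x hx
    obtain ⟨k, hk⟩ := hy x hx
    refine ⟨c * k, ?_⟩
    rw [← Int.cast_smul_eq_zsmul ℝ c y, real_inner_smul_right, hk]
    push_cast
    rfl

/-- The `j`-th successive minimum with respect to the Euclidean unit ball:
`inf { r > 0 : dim span (Λ ∩ r B_d) ≥ j }`. -/
def successiveMinimum {d : ℕ} (L : Submodule ℤ (EuclideanSpace ℝ (Fin d))) (j : ℕ) : ℝ :=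
  sInf {r : ℝ | 0 < r ∧ j ≤ Module.finrank ℝ
    (Submodule.span ℝ ((L : Set (EuclideanSpace ℝ (Fin d))) ∩ Metric.closedBall 0 r))}

/-- `b` is a lattice basis of `L`. -/
def IsLatticeBasis {d : ℕ} (L : Submodule ℤ (EuclideanSpace ℝ (Fin d)))
    (b : Fin d → EuclideanSpace ℝ (Fin d)) : Prop :=
  LinearIndependent ℝ b ∧ Submodule.span ℤ (Set.range b) = L

/-- Gram–Schmidt coefficient `μ_{k,l} = ⟨b_k, b_l^*⟩ / ⟨b_l^*, b_l^*⟩`. -/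
def gramSchmidtCoeff {d : ℕ} (b : Fin d → EuclideanSpace ℝ (Fin d)) (k l : Fin d) : ℝ :=
  inner ℝ (b k) (InnerProductSpace.gramSchmidt ℝ b l) /
    ‖InnerProductSpace.gramSchmidt ℝ b l‖ ^ 2

/-- LLL-reducedness with parameter `δ`: size reduction and the Lovász condition. -/
structure IsLLLReduced {d : ℕ} (δ : ℝ) (b : Fin d → EuclideanSpace ℝ (Fin d)) : Prop where
  size_reduced : ∀ k l : Fin d, l < k → |gramSchmidtCoeff b k l| ≤ 1 / 2
  lovasz : ∀ k l : Fin d, (l : ℕ) + 1 = (k : ℕ) →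
    δ * ‖InnerProductSpace.gramSchmidt ℝ b l‖ ^ 2 ≤
      ‖InnerProductSpace.gramSchmidt ℝ b k‖ ^ 2 +
        gramSchmidtCoeff b k l ^ 2 * ‖InnerProductSpace.gramSchmidt ℝ b l‖ ^ 2

/-- The length of the shortest vector among the members of a basis. -/
def shortestLength {d : ℕ} (b : Fin d → EuclideanSpace ℝ (Fin d)) : ℝ := ⨅ j, ‖b j‖

open Classical in
/-- One pass of the search loop; the state is `(score_max, a^*)`. -/
def searchStep (score : ℕ → ℝ) (s : ℝ × ℕ) (a : ℕ) : ℝ × ℕ :=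
  if s.1 < score a then (score a, a) else s

/-- The exhaustive search: start with `score_max = 0`, `a^* = 1`, run through
`a = 1, …, N - 1`, and return `a^*`. -/
def exhaustiveSearch (score : ℕ → ℝ) (N : ℕ) : ℕ :=
  ((List.range' 1 (N - 1)).foldl (searchStep score) (0, 1)).2

/-- The exact score `λ_1(Λ_a) λ_1(Λ_a^⊥)`. -/
def exactScore (d N a : ℕ) : ℝ :=
  successiveMinimum (korobovLattice d N a) 1 *
    successiveMinimum (dualLattice (korobovLattice d N a)) 1

end

/-!
An integer vector `h` belongs to `Λ_a^⊥` iff `a` is a root modulo `N` of the polynomial with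
coefficients `h`, which has fewer than `d` roots unless `h` vanishes modulo `N`. Counting the short
vectors `h` therefore leaves some `a` with `λ₁(Λ_a^⊥) ≳ N ^ (1 / d)`.

A large `λ₁(Λ^⊥)` makes `Λ` well distributed: every character of `Λ^⊥` has the form
`y ↦ ⟪x, y⟫ mod 1` with `‖x‖ ≲ 1 / λ₁(Λ^⊥)`, by induction on the rank, projecting along a nearly
shortest vector. For the character of an arbitrary point `t` this `x` is the difference of `t` and a
point of `Λ^⊥⊥ = Λ`, so the covering radius of `Λ` is `≲ 1 / λ₁(Λ^⊥)`. Translates by `Λ` of a box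
with sides of twice that length then cover space, and still do so after the side along a shortest
vector is cut down to `λ₁(Λ)`; the volume of this box is at least the covolume `1 / N`, so that
`λ₁(Λ) λ₁(Λ^⊥) ≳ λ₁(Λ^⊥) ^ d / N`. Hence the best score is bounded below independently of `N`.

The mesh ratio is `≲ 1 / (λ₁(Λ) λ₁(Λ^⊥))`, and the first vector of an LLL-reduced basis is shortest
up to a constant factor, so both searches return parameters with bounded mesh ratio.
-/

noncomputable section

section NearShortest

variable {E : Type*} [NormedAddCommGroup E]

/-- A nonzero vector of `M` that is shortest up to the factor `4 / 3`. Such vectors exist as soon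
as the nonzero vectors of `M` are bounded away from `0`, so attainment of the first minimum is
never needed. -/
structure IsNearShortest (M : Submodule ℤ E) (v : E) : Prop where
  mem : v ∈ M
  ne_zero : v ≠ 0
  norm_le : ∀ w ∈ M, w ≠ 0 → ‖v‖ ≤ 4 / 3 * ‖w‖

theorem exists_isNearShortest {M : Submodule ℤ E} (hM : M ≠ ⊥) {m : ℝ} (hm : 0 < m)
    (h : ∀ y ∈ M, y ≠ 0 → m ≤ ‖y‖) : ∃ v, IsNearShortest M v := by
  set S : Set ℝ := norm '' {y | y ∈ M ∧ y ≠ 0}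
  have hS : S.Nonempty := Set.Nonempty.image _ ((Submodule.ne_bot_iff M).1 hM)
  have hmS : ∀ r ∈ S, m ≤ r := by
    rintro _ ⟨y, hy, rfl⟩
    exact h y hy.1 hy.2
  have hpos : 0 < sInf S := hm.trans_le (le_csInf hS hmS)
  obtain ⟨_, ⟨v, ⟨hv, hv0⟩, rfl⟩, hvS⟩ :=
    exists_lt_of_csInf_lt hS (show sInf S < 4 / 3 * sInf S by linarith)
  refine ⟨v, hv, hv0, fun w hw hw0 => hvS.le.trans ?_⟩
  gcongr
  exact csInf_le ⟨m, hmS⟩ ⟨w, ⟨hw, hw0⟩, rfl⟩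

end NearShortest

section Characters

open Submodule

variable {E : Type*} [NormedAddCommGroup E] [InnerProductSpace ℝ E]

theorem starProjection_orthogonal_sub_zsmul (v y : E) (k : ℤ) :
    (ℝ ∙ v)ᗮ.starProjection (y - k • v) = (ℝ ∙ v)ᗮ.starProjection y := by
  have hv : (ℝ ∙ v)ᗮ.starProjection v = 0 :=
    starProjection_orthogonal_apply_eq_zero (mem_span_singleton_self v)
  rw [map_sub, map_zsmul, hv, smul_zero, sub_zero]

theorem exists_int_norm_sub_zsmul_sq_le (v y : E) :
    ∃ k : ℤ, ‖y - k • v‖ ^ 2 ≤ ‖(ℝ ∙ v)ᗮ.starProjection y‖ ^ 2 + ‖v‖ ^ 2 / 4 := by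
  set s := inner ℝ v y / ‖v‖ ^ 2
  have hproj : ‖(ℝ ∙ v).starProjection (y - round s • v)‖ ≤ 1 / 2 * ‖v‖ := by
    have hv : (ℝ ∙ v).starProjection v = v :=
      starProjection_eq_self_iff.2 (mem_span_singleton_self v)
    have hy : (ℝ ∙ v).starProjection y = s • v := starProjection_singleton ℝ y
    rw [map_sub, map_zsmul, hv, hy, ← Int.cast_smul_eq_zsmul ℝ, ← sub_smul, norm_smul]
    gcongr
    exact abs_sub_round s
  refine ⟨round s, ?_⟩
  rw [norm_sq_eq_add_norm_sq_starProjection (y - round s • v) (ℝ ∙ v),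
    starProjection_orthogonal_sub_zsmul]
  nlinarith [norm_nonneg v, norm_nonneg ((ℝ ∙ v).starProjection (y - round s • v))]

variable {M : Submodule ℤ E} {v y : E}

theorem IsNearShortest.exists_zsmul_eq (hv : IsNearShortest M v) (hy : y ∈ M)
    (h : (ℝ ∙ v)ᗮ.starProjection y = 0) : ∃ k : ℤ, k • v = y := by
  obtain ⟨k, hk⟩ := exists_int_norm_sub_zsmul_sq_le v y
  refine ⟨k, (sub_eq_zero.1 (by_contra fun hw => ?_)).symm⟩
  have hle := hv.norm_le _ (M.sub_mem hy (M.smul_mem k hv.mem)) hw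
  rw [h, norm_zero] at hk
  nlinarith [norm_pos_iff.2 hv.ne_zero]

theorem IsNearShortest.norm_le_two_mul (hv : IsNearShortest M v) (hy : y ∈ M)
    (h : (ℝ ∙ v)ᗮ.starProjection y ≠ 0) : ‖v‖ ≤ 2 * ‖(ℝ ∙ v)ᗮ.starProjection y‖ := by
  obtain ⟨k, hk⟩ := exists_int_norm_sub_zsmul_sq_le v y
  have hw : y - k • v ≠ 0 := fun hw => h (by
    rw [← starProjection_orthogonal_sub_zsmul v y k, hw, map_zero])
  have hle := hv.norm_le _ (M.sub_mem hy (M.smul_mem k hv.mem)) hw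
  nlinarith [norm_nonneg v, norm_nonneg ((ℝ ∙ v)ᗮ.starProjection y)]

/-- The orthogonal projection of `M` to the complement of `v`. It has smaller rank than `M`, and its
nonzero vectors stay bounded away from `0` when `v` is nearly shortest, so that one can induct. -/
def projectAlong (v : E) (M : Submodule ℤ E) : Submodule ℤ E :=
  M.map ((ℝ ∙ v)ᗮ.starProjection.toLinearMap.restrictScalars ℤ)

theorem IsNearShortest.half_le_norm_of_mem_projectAlong (hv : IsNearShortest M v) {m : ℝ}
    (h : ∀ y ∈ M, y ≠ 0 → m ≤ ‖y‖) (hy : y ∈ projectAlong v M) (hy0 : y ≠ 0) : m / 2 ≤ ‖y‖ := by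
  obtain ⟨z, hz, rfl⟩ := hy
  change m / 2 ≤ ‖(ℝ ∙ v)ᗮ.starProjection z‖
  linarith [h v hv.mem hv.ne_zero, hv.norm_le_two_mul hz hy0]

theorem finrank_span_projectAlong_lt [FiniteDimensional ℝ E] (hv : v ∈ M) (hv0 : v ≠ 0) :
    Module.finrank ℝ (span ℝ (projectAlong v M : Set E)) <
      Module.finrank ℝ (span ℝ (M : Set E)) := by
  have hvM : v ∈ span ℝ (M : Set E) := subset_span hv
  have hle : span ℝ (projectAlong v M : Set E) ≤ span ℝ (M : Set E) := by
    refine span_le.2 ?_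
    rintro _ ⟨y, hy, rfl⟩
    change (ℝ ∙ v)ᗮ.starProjection y ∈ span ℝ (M : Set E)
    rw [starProjection_orthogonal_val, starProjection_singleton]
    exact sub_mem (subset_span hy) (smul_mem _ _ hvM)
  have horth : span ℝ (projectAlong v M : Set E) ≤ (ℝ ∙ v)ᗮ := by
    refine span_le.2 ?_
    rintro _ ⟨y, -, rfl⟩
    exact starProjection_apply_mem _ y
  refine finrank_lt_finrank_of_lt (hle.lt_of_ne fun h => hv0 ?_)
  exact inner_self_eq_zero.1 (mem_orthogonal_singleton_iff_inner_right.1 (horth (h ▸ hvM)))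

theorem exists_abs_le_half_coe_eq (α : AddCircle (1 : ℝ)) :
    ∃ t : ℝ, |t| ≤ 1 / 2 ∧ (t : AddCircle (1 : ℝ)) = α := by
  obtain ⟨s, rfl⟩ := QuotientAddGroup.mk_surjective α
  refine ⟨s - round s, abs_sub_round s, ?_⟩
  rw [AddCircle.coe_sub, sub_eq_self, AddCircle.coe_eq_zero_iff]
  exact ⟨round s, by simp⟩

theorem exists_smul_inner_coe_eq (hv0 : v ≠ 0) (α : AddCircle (1 : ℝ)) :
    ∃ c : ℝ, ‖c • v‖ ≤ 1 / (2 * ‖v‖) ∧ ((inner ℝ (c • v) v : ℝ) : AddCircle (1 : ℝ)) = α := by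
  have hv : 0 < ‖v‖ := norm_pos_iff.2 hv0
  obtain ⟨t, ht, rfl⟩ := exists_abs_le_half_coe_eq α
  refine ⟨t / ‖v‖ ^ 2, ?_, ?_⟩
  · calc ‖(t / ‖v‖ ^ 2) • v‖ = |t| / ‖v‖ := by
          rw [norm_smul, Real.norm_eq_abs, abs_div, abs_of_pos (pow_pos hv 2)]
          field_simp
      _ ≤ 1 / 2 / ‖v‖ := by gcongr
      _ = 1 / (2 * ‖v‖) := by rw [div_div]
  · rw [real_inner_smul_left, real_inner_self_eq_norm_sq, div_mul_cancel₀ _ (pow_pos hv 2).ne']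

/-- The character `y ↦ ⟪x, y⟫ mod 1`. Its restriction to a lattice is trivial exactly when `x` lies
in the dual lattice. -/
def innerCharacter (x : E) : E →+ AddCircle (1 : ℝ) :=
  (QuotientAddGroup.mk' _).comp (innerₗ E x).toAddMonoidHom

theorem innerCharacter_apply (x y : E) :
    innerCharacter x y = ((inner ℝ x y : ℝ) : AddCircle (1 : ℝ)) := rfl

theorem exists_character_projectAlong (hv : IsNearShortest M v) {g : M →+ AddCircle (1 : ℝ)}
    (hg : g ⟨v, hv.mem⟩ = 0) :
    ∃ g' : projectAlong v M →+ AddCircle (1 : ℝ), ∀ y : M,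
      g' ⟨(ℝ ∙ v)ᗮ.starProjection y, mem_map_of_mem y.2⟩ = g y := by
  let φ : M →+ projectAlong v M :=
    (((ℝ ∙ v)ᗮ.starProjection.toLinearMap.restrictScalars ℤ).submoduleMap M).toAddMonoidHom
  have hφ : Function.Surjective φ := LinearMap.submoduleMap_surjective _ M
  have hker : φ.ker ≤ g.ker := by
    rintro ⟨y, hy⟩ h
    obtain ⟨k, rfl⟩ := hv.exists_zsmul_eq hy (congrArg Subtype.val (AddMonoidHom.mem_ker.1 h))
    have hy : (⟨k • v, hy⟩ : M) = k • ⟨v, hv.mem⟩ := rfl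
    rw [AddMonoidHom.mem_ker, hy, map_zsmul, hg, smul_zero]
  exact ⟨AddMonoidHom.liftOfSurjective φ hφ ⟨g, hker⟩, fun y =>
    AddMonoidHom.liftOfRightInverse_comp_apply φ _ _ ⟨g, hker⟩ y⟩

theorem IsNearShortest.exists_innerCharacter_eq (hv : IsNearShortest M v)
    (f : M →+ AddCircle (1 : ℝ)) {r : ℝ}
    (hproj : ∀ g : projectAlong v M →+ AddCircle (1 : ℝ),
      ∃ x : E, ‖x‖ ≤ r ∧ ∀ y : projectAlong v M, innerCharacter x y = g y) :
    ∃ x : E, ‖x‖ ≤ 1 / (2 * ‖v‖) + r ∧ ∀ y : M, innerCharacter x y = f y := by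
  obtain ⟨c, hc, hcv⟩ := exists_smul_inner_coe_eq hv.ne_zero (f ⟨v, hv.mem⟩)
  obtain ⟨g, hg⟩ := exists_character_projectAlong hv
    (g := f - (innerCharacter (c • v)).comp M.subtype.toAddMonoidHom) (sub_eq_zero.2 hcv.symm)
  obtain ⟨x, hx, hxg⟩ := hproj g
  refine ⟨c • v + (ℝ ∙ v)ᗮ.starProjection x,
    norm_add_le_of_le hc ((norm_starProjection_apply_le _ _).trans hx), fun y => ?_⟩
  have hxy : innerCharacter x ((ℝ ∙ v)ᗮ.starProjection y) = f y - innerCharacter (c • v) y :=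
    (hxg _).trans (hg y)
  rw [innerCharacter_apply, inner_add_left, inner_starProjection_left_eq_right,
    AddCircle.coe_add, ← innerCharacter_apply, ← innerCharacter_apply, hxy, add_sub_cancel]

theorem exists_innerCharacter_eq [FiniteDimensional ℝ E] (n : ℕ) {M : Submodule ℤ E}
    (hn : Module.finrank ℝ (span ℝ (M : Set E)) ≤ n) {m : ℝ} (hm : 0 < m)
    (h : ∀ y ∈ M, y ≠ 0 → m ≤ ‖y‖) (f : M →+ AddCircle (1 : ℝ)) :
    ∃ x : E, ‖x‖ ≤ (2 ^ n - 1) / (2 * m) ∧ ∀ y : M, innerCharacter x y = f y := by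
  induction n generalizing M m with
  | zero =>
    rw [Nat.le_zero, finrank_eq_zero, span_eq_bot] at hn
    refine ⟨0, by simp, fun y => ?_⟩
    rw [show y = 0 from Subtype.ext (hn y y.2), map_zero, ZeroMemClass.coe_zero, map_zero]
  | succ n ih =>
    rcases eq_or_ne M ⊥ with rfl | hM
    · have hbot : Module.finrank ℝ (span ℝ ((⊥ : Submodule ℤ E) : Set E)) ≤ n := by
        rw [bot_coe, span_zero_singleton, finrank_bot]
        exact n.zero_le
      obtain ⟨x, hx, hxf⟩ := ih hbot hm h f
      refine ⟨x, hx.trans ?_, hxf⟩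
      gcongr <;> norm_num
    obtain ⟨v, hv⟩ := exists_isNearShortest hM hm h
    obtain ⟨x, hx, hxf⟩ := hv.exists_innerCharacter_eq f <|
      ih (Nat.lt_succ_iff.1 <| (finrank_span_projectAlong_lt hv.mem hv.ne_zero).trans_le hn)
        (half_pos hm) fun _ => hv.half_le_norm_of_mem_projectAlong h
    refine ⟨x, ?_, hxf⟩
    calc ‖x‖ ≤ 1 / (2 * ‖v‖) + (2 ^ n - 1) / (2 * (m / 2)) := hx
      _ ≤ 1 / (2 * m) + (2 ^ n - 1) / (2 * (m / 2)) := by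
          gcongr
          exact h v hv.mem hv.ne_zero
      _ = (2 ^ (n + 1) - 1) / (2 * m) := by
          field_simp
          ring

end Characters

section Dual

open Submodule

variable {d : ℕ} {L : Submodule ℤ (EuclideanSpace ℝ (Fin d))}

theorem dualLattice_eq_dualSubmodule (L : Submodule ℤ (EuclideanSpace ℝ (Fin d))) :
    dualLattice L = LinearMap.BilinForm.dualSubmodule (innerₗ (EuclideanSpace ℝ (Fin d))) L := by
  ext y
  rw [LinearMap.BilinForm.mem_dualSubmodule]
  refine forall₂_congr fun x _ => ?_
  rw [Submodule.mem_one, real_inner_comm]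
  simp [eq_comm]

theorem dualLattice_dualLattice (L : Submodule ℤ (EuclideanSpace ℝ (Fin d)))
    [DiscreteTopology L] [IsZLattice ℝ L] : dualLattice (dualLattice L) = L := by
  let b := (Module.Free.chooseBasis ℤ L).ofZLatticeBasis ℝ L
  have hb : span ℤ (Set.range b) = L := (Module.Free.chooseBasis ℤ L).ofZLatticeBasis_span ℝ L
  have hnondeg : (innerₗ (EuclideanSpace ℝ (Fin d))).Nondegenerate :=
    ⟨fun x hx => inner_self_eq_zero.1 (hx x), fun x hx => inner_self_eq_zero.1 (hx x)⟩
  rw [dualLattice_eq_dualSubmodule, dualLattice_eq_dualSubmodule, ← hb]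
  exact LinearMap.BilinForm.dualSubmodule_dualSubmodule_of_basis (innerₗ _) hnondeg
    ⟨fun x y => real_inner_comm y x⟩ b

theorem exists_mem_norm_sub_le [DiscreteTopology L] [IsZLattice ℝ L] {m : ℝ} (hm : 0 < m)
    (h : ∀ y ∈ dualLattice L, y ≠ 0 → m ≤ ‖y‖) (t : EuclideanSpace ℝ (Fin d)) :
    ∃ x ∈ L, ‖t - x‖ ≤ 2 ^ d / m := by
  obtain ⟨x, hx, hxt⟩ := exists_innerCharacter_eq d (M := dualLattice L)
    ((finrank_le _).trans_eq finrank_euclideanSpace_fin) hm h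
    ((innerCharacter t).comp (dualLattice L).subtype.toAddMonoidHom)
  refine ⟨t - x, ?_, ?_⟩
  · rw [← dualLattice_dualLattice L]
    intro y hy
    have : ((inner ℝ (t - x) y : ℝ) : AddCircle (1 : ℝ)) = 0 := by
      rw [inner_sub_left, AddCircle.coe_sub, sub_eq_zero]
      exact (hxt ⟨y, hy⟩).symm
    obtain ⟨k, hk⟩ := (AddCircle.coe_eq_zero_iff 1).1 this
    exact ⟨k, by rw [real_inner_comm, ← hk, zsmul_one]⟩
  · rw [sub_sub_cancel]
    refine hx.trans ?_
    rw [div_le_div_iff₀ (by positivity) hm]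
    nlinarith [pow_pos (two_pos (α := ℝ)) d]

end Dual

theorem relIndex_zmultiples_sup_dvd {G : Type*} [AddCommGroup G] {K : AddSubgroup G} {g : G}
    {n : ℕ} (h : n • g ∈ K) : K.relIndex (AddSubgroup.zmultiples g ⊔ K) ∣ n := by
  have hle : AddSubgroup.zmultiples (n : ℤ) ≤ K.comap (zmultiplesHom G g) := by
    rw [AddSubgroup.zmultiples_le]
    simpa using h
  rw [AddSubgroup.relIndex_sup_right, ← AddSubgroup.range_zmultiplesHom, AddMonoidHom.range_eq_map,
    ← AddSubgroup.relIndex_comap, AddSubgroup.relIndex_top_right]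
  simpa using AddSubgroup.index_dvd_of_le hle

section Volume

open MeasureTheory Pointwise

theorem measure_fundamentalDomain_le {G α : Type*} [AddGroup G] [Countable G] [AddAction G α]
    [MeasurableSpace α] {μ : Measure α} [MeasurableConstVAdd G α] [VAddInvariantMeasure G α μ]
    {F S : Set α} (hF : IsAddFundamentalDomain G F μ) (hS : ∀ t, ∃ g : G, t ∈ g +ᵥ S) :
    μ F ≤ μ S := by
  rw [hF.measure_eq_tsum S]
  refine (measure_mono fun t ht => ?_).trans (measure_iUnion_le _)
  obtain ⟨g, hg⟩ := hS t
  exact Set.mem_iUnion.2 ⟨g, hg, ht⟩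

variable {E : Type*} [NormedAddCommGroup E] [InnerProductSpace ℝ E] [FiniteDimensional ℝ E]

theorem exists_orthonormalBasis_smul_eq {v : E} (hv : v ≠ 0) :
    ∃ (b : OrthonormalBasis (Fin (Module.finrank ℝ E)) ℝ E) (i : Fin (Module.finrank ℝ E)),
      ‖v‖ • b i = v := by
  have := nontrivial_of_ne v 0 hv
  let i : Fin (Module.finrank ℝ E) := ⟨0, Module.finrank_pos⟩
  have hnorm : ‖‖v‖⁻¹ • v‖ = 1 := norm_smul_inv_norm hv
  obtain ⟨b, hb⟩ := Orthonormal.exists_orthonormalBasis_extension_of_card_eq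
    (𝕜 := ℝ) (E := E) (ι := Fin (Module.finrank ℝ E)) (by simp) (v := fun _ => ‖v‖⁻¹ • v) (s := {i})
    ⟨fun _ => hnorm, fun j k hjk => absurd (Subsingleton.elim j k) hjk⟩
  exact ⟨b, i, by rw [hb i rfl, smul_inv_smul₀ (norm_ne_zero_iff.2 hv)]⟩

variable [MeasurableSpace E] [BorelSpace E]

theorem covolume_le_measureReal {L : Submodule ℤ E} [DiscreteTopology L] [IsZLattice ℝ L]
    {S : Set E} (hS : ∀ t, ∃ x ∈ L, t - x ∈ S) (hfin : volume S ≠ ⊤) :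
    ZLattice.covolume L ≤ volume.real S := by
  have hF := ZLattice.isAddFundamentalDomain (Module.Free.chooseBasis ℤ L) (volume : Measure E)
  rw [ZLattice.covolume_eq_measure_fundamentalDomain L volume hF]
  have : Countable L.toAddSubgroup := inferInstanceAs (Countable L)
  refine ENNReal.toReal_mono hfin
    (measure_fundamentalDomain_le (G := L.toAddSubgroup) hF fun t => ?_)
  obtain ⟨x, hx, hxS⟩ := hS t
  exact ⟨⟨x, hx⟩, t - x, hxS, add_sub_cancel x t⟩

theorem covolume_span_orthonormalBasis {ι : Type*} [Fintype ι] (b : OrthonormalBasis ι ℝ E) :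
    ZLattice.covolume (Submodule.span ℤ (Set.range b)) = 1 := by
  have h : volume (ZSpan.fundamentalDomain b.toBasis) = 1 := by
    rw [measure_congr (ZSpan.fundamentalDomain_ae_parallelepiped b.toBasis volume),
      b.coe_toBasis, b.volume_parallelepiped]
  have hF := ZSpan.isAddFundamentalDomain b.toBasis (volume : Measure E)
  rw [← b.coe_toBasis, ZLattice.covolume_eq_measure_fundamentalDomain _ volume hF,
    Measure.real, h, ENNReal.toReal_one]

theorem volume_abs_inner_le {ι : Type*} [Fintype ι] (b : OrthonormalBasis ι ℝ E) (r : ι → ℝ) :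
    volume {w | ∀ i, |inner ℝ (b i) w| ≤ r i / 2} = ∏ i, ENNReal.ofReal (r i) := by
  have hrepr := (EuclideanSpace.volume_preserving_symm_measurableEquiv_toLp ι).comp
    b.measurePreserving_repr
  have hpre : {w | ∀ i, |inner ℝ (b i) w| ≤ r i / 2} =
      ((MeasurableEquiv.toLp 2 (ι → ℝ)).symm ∘ b.repr) ⁻¹' Set.Icc (-fun i => r i / 2)
        fun i => r i / 2 := by
    ext w
    simp [abs_le, Pi.le_def, forall_and, b.repr_apply_apply]
  rw [hpre, hrepr.measure_preimage measurableSet_Icc.nullMeasurableSet, Real.volume_Icc_pi]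
  simp only [Pi.neg_apply, sub_neg_eq_add, add_halves]

theorem covolume_le_prod {ι : Type*} [Fintype ι] {L : Submodule ℤ E} [DiscreteTopology L]
    [IsZLattice ℝ L] (b : OrthonormalBasis ι ℝ E) {r : ι → ℝ} (hr : ∀ i, 0 ≤ r i)
    (h : ∀ t, ∃ x ∈ L, ∀ i, |inner ℝ (b i) (t - x)| ≤ r i / 2) :
    ZLattice.covolume L ≤ ∏ i, r i := by
  have hvol : volume {w | ∀ i, |inner ℝ (b i) w| ≤ r i / 2} = ENNReal.ofReal (∏ i, r i) := by
    rw [volume_abs_inner_le, ENNReal.ofReal_prod_of_nonneg fun i _ => hr i]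
  refine (covolume_le_measureReal h (hvol ▸ ENNReal.ofReal_ne_top)).trans_eq ?_
  rw [Measure.real, hvol, ENNReal.toReal_ofReal (Finset.prod_nonneg fun i _ => hr i)]

theorem abs_sub_round_div_mul_le (s : ℝ) {r : ℝ} (hr : 0 < r) :
    |s - round (s / r) * r| ≤ r / 2 := by
  calc |s - round (s / r) * r| = |s / r - round (s / r)| * r := by
        rw [← abs_of_pos hr, ← abs_mul, abs_of_pos hr, sub_mul, div_mul_cancel₀ s hr.ne']
    _ ≤ 1 / 2 * r := by gcongr; exact abs_sub_round _
    _ = r / 2 := by ring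

theorem covolume_le_norm_mul_pow {L : Submodule ℤ E} [DiscreteTopology L] [IsZLattice ℝ L]
    {v : E} (hv : v ∈ L) (hv0 : v ≠ 0) {μ : ℝ} (hμ : ∀ t, ∃ x ∈ L, ‖t - x‖ ≤ μ) :
    ZLattice.covolume L ≤ ‖v‖ * (2 * μ) ^ (Module.finrank ℝ E - 1) := by
  have hμ0 : 0 ≤ μ := (norm_nonneg _).trans (hμ 0).choose_spec.2
  obtain ⟨b, i₀, hb⟩ := exists_orthonormalBasis_smul_eq hv0
  -- Enclose a ball of radius `μ` in a box, then shorten its edge along `v` to `‖v‖` by translating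
  -- with multiples of `v`.
  let r : Fin (Module.finrank ℝ E) → ℝ := Function.update (fun _ => 2 * μ) i₀ ‖v‖
  have hr₀ : r i₀ = ‖v‖ := Function.update_self ..
  have hr : ∀ i ≠ i₀, r i = 2 * μ := fun i hi => Function.update_of_ne hi ..
  have hprod : ∏ i, r i = ‖v‖ * (2 * μ) ^ (Module.finrank ℝ E - 1) := by
    rw [Finset.prod_update_of_mem (Finset.mem_univ _), Finset.prod_const,
      Finset.card_univ_sdiff, Fintype.card_fin, Finset.card_singleton]
  refine (covolume_le_prod b (fun i => ?_) fun t => ?_).trans_eq hprod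
  · rcases eq_or_ne i i₀ with rfl | hi
    · exact hr₀ ▸ norm_nonneg v
    · exact hr i hi ▸ mul_nonneg two_pos.le hμ0
  obtain ⟨x, hx, hxt⟩ := hμ t
  set k := round (inner ℝ (b i₀) (t - x) / ‖v‖)
  have hinner : ∀ i, inner ℝ (b i) (t - (x + k • v)) =
      inner ℝ (b i) (t - x) - k * ‖v‖ * inner ℝ (b i) (b i₀) := fun i => by
    nth_rw 1 [← hb]
    rw [← sub_sub, inner_sub_right, ← Int.cast_smul_eq_zsmul ℝ, smul_smul, real_inner_smul_right]
  refine ⟨x + k • v, L.add_mem hx (L.smul_mem k hv), fun i => ?_⟩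
  rw [hinner, b.inner_eq_ite]
  rcases eq_or_ne i i₀ with rfl | hi
  · rw [if_pos rfl, mul_one, hr₀]
    exact abs_sub_round_div_mul_le _ (norm_pos_iff.2 hv0)
  · rw [if_neg hi, mul_zero, sub_zero, hr i hi, mul_div_cancel_left₀ μ two_ne_zero]
    refine (abs_real_inner_le_norm _ _).trans ?_
    rwa [b.norm_eq_one, one_mul]

end Volume

section FirstMinimum

open Submodule

variable {d : ℕ} {L : Submodule ℤ (EuclideanSpace ℝ (Fin d))}

theorem one_le_finrank_span_inter_closedBall_iff {r : ℝ} :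
    1 ≤ Module.finrank ℝ (span ℝ ((L : Set (EuclideanSpace ℝ (Fin d))) ∩ Metric.closedBall 0 r)) ↔
      ∃ x ∈ L, x ≠ 0 ∧ ‖x‖ ≤ r := by
  rw [Nat.one_le_iff_ne_zero, Ne, finrank_eq_zero, span_eq_bot]
  simp only [Set.mem_inter_iff, SetLike.mem_coe, mem_closedBall_zero_iff]
  push Not
  exact exists_congr fun x => by tauto

theorem successiveMinimum_nonneg (L : Submodule ℤ (EuclideanSpace ℝ (Fin d))) (j : ℕ) :
    0 ≤ successiveMinimum L j :=
  Real.sInf_nonneg fun _ hr => hr.1.le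

theorem successiveMinimum_one_le {x : EuclideanSpace ℝ (Fin d)} (hx : x ∈ L) (h0 : x ≠ 0) :
    successiveMinimum L 1 ≤ ‖x‖ :=
  csInf_le ⟨0, fun _ hr => hr.1.le⟩ ⟨norm_pos_iff.2 h0,
    one_le_finrank_span_inter_closedBall_iff.2 ⟨x, hx, h0, le_rfl⟩⟩

theorem le_successiveMinimum_one {m : ℝ} (hL : L ≠ ⊥) (h : ∀ x ∈ L, x ≠ 0 → m ≤ ‖x‖) :
    m ≤ successiveMinimum L 1 := by
  obtain ⟨x, hx, h0⟩ := (Submodule.ne_bot_iff _).1 hL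
  refine le_csInf ⟨‖x‖, norm_pos_iff.2 h0,
    one_le_finrank_span_inter_closedBall_iff.2 ⟨x, hx, h0, le_rfl⟩⟩ ?_
  rintro r ⟨-, hr⟩
  obtain ⟨y, hy, hy0, hyr⟩ := one_le_finrank_span_inter_closedBall_iff.1 hr
  exact (h y hy hy0).trans hyr

end FirstMinimum

section RankOneLattice

open Submodule

variable {d N : ℕ} {z : Fin d → ℕ} {x : EuclideanSpace ℝ (Fin d)}

theorem mem_span_basisFun_iff :
    x ∈ span ℤ (Set.range (EuclideanSpace.basisFun (Fin d) ℝ)) ↔ ∀ j, ∃ k : ℤ, x j = k := by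
  rw [← OrthonormalBasis.coe_toBasis, Module.Basis.mem_span_iff_repr_mem]
  simp [eq_comm]

theorem one_le_norm_of_mem_span_basisFun
    (hx : x ∈ span ℤ (Set.range (EuclideanSpace.basisFun (Fin d) ℝ))) (h0 : x ≠ 0) :
    1 ≤ ‖x‖ := by
  obtain ⟨j, hj⟩ : ∃ j, x j ≠ 0 := by
    by_contra! hx
    exact h0 (PiLp.ext hx)
  obtain ⟨k, hk⟩ := mem_span_basisFun_iff.1 hx j
  have hk0 : k ≠ 0 := fun h => hj (by rw [hk, h, Int.cast_zero])
  calc (1 : ℝ) ≤ |(k : ℝ)| := by exact_mod_cast Int.one_le_abs hk0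
    _ = ‖x j‖ := by rw [hk, Real.norm_eq_abs]
    _ ≤ ‖x‖ := PiLp.norm_apply_le x j

theorem mem_rankOneLattice_iff :
    x ∈ rankOneLattice N z ↔ ∃ n : ℤ, ∀ j, ∃ k : ℤ, x j = n * ((z j : ℝ) / N) + k := by
  rw [rankOneLattice, mem_sup]
  constructor
  · rintro ⟨u, hu, w, hw, rfl⟩
    obtain ⟨n, rfl⟩ := mem_span_singleton.1 hu
    refine ⟨n, fun j => (mem_span_basisFun_iff.1 hw j).imp fun k hk => ?_⟩
    simp [hk]
  · rintro ⟨n, h⟩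
    refine ⟨_, smul_mem _ n (mem_span_singleton_self _), _, mem_span_basisFun_iff.2 fun j => ?_,
      add_sub_cancel _ x⟩
    obtain ⟨k, hk⟩ := h j
    exact ⟨k, by simp [hk]⟩

theorem basisFun_mem_rankOneLattice (N : ℕ) (z : Fin d → ℕ) (j : Fin d) :
    EuclideanSpace.basisFun (Fin d) ℝ j ∈ rankOneLattice N z :=
  mem_sup_right (subset_span ⟨j, rfl⟩)

theorem natCast_smul_mem_span_basisFun (hN : 0 < N) (hx : x ∈ rankOneLattice N z) :
    (N : ℝ) • x ∈ span ℤ (Set.range (EuclideanSpace.basisFun (Fin d) ℝ)) := by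
  obtain ⟨n, h⟩ := mem_rankOneLattice_iff.1 hx
  refine mem_span_basisFun_iff.2 fun j => ?_
  obtain ⟨k, hk⟩ := h j
  have hN' : (N : ℝ) ≠ 0 := by exact_mod_cast hN.ne'
  refine ⟨n * z j + N * k, ?_⟩
  rw [PiLp.smul_apply, hk, smul_eq_mul]
  push_cast
  field_simp

theorem discreteTopology_rankOneLattice (hN : 0 < N) (z : Fin d → ℕ) :
    DiscreteTopology (rankOneLattice N z) := by
  have hN' : (0 : ℝ) < N := by exact_mod_cast hN
  refine DiscreteTopology.of_forall_le_dist (inv_pos.2 hN') fun x y hxy => ?_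
  have h0 : (N : ℝ) • (x - y : EuclideanSpace ℝ (Fin d)) ≠ 0 :=
    smul_ne_zero hN'.ne' (sub_ne_zero.2 (Subtype.coe_injective.ne hxy))
  have h1 := one_le_norm_of_mem_span_basisFun
    (natCast_smul_mem_span_basisFun hN (sub_mem x.2 y.2)) h0
  rwa [norm_smul, Real.norm_natCast, ← inv_le_iff_one_le_mul₀' hN', ← dist_eq_norm] at h1

theorem isZLattice_rankOneLattice [DiscreteTopology (rankOneLattice N z)] :
    IsZLattice ℝ (rankOneLattice N z) where
  span_top := by
    rw [eq_top_iff, ← (EuclideanSpace.basisFun (Fin d) ℝ).toBasis.span_eq,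
      OrthonormalBasis.coe_toBasis]
    exact span_mono (Set.range_subset_iff.2 (basisFun_mem_rankOneLattice N z))

theorem relIndex_rankOneLattice_dvd (hN : 0 < N) (z : Fin d → ℕ) :
    (span ℤ (Set.range (EuclideanSpace.basisFun (Fin d) ℝ))).toAddSubgroup.relIndex
      (rankOneLattice N z).toAddSubgroup ∣ N := by
  rw [rankOneLattice, sup_toAddSubgroup, span_singleton_toAddSubgroup_eq_zmultiples]
  refine relIndex_zmultiples_sup_dvd ?_
  rw [← Nat.cast_smul_eq_nsmul ℝ]
  exact natCast_smul_mem_span_basisFun hN (z := z) (mem_sup_left (mem_span_singleton_self _))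

theorem one_le_mul_covolume_rankOneLattice (hN : 0 < N) (z : Fin d → ℕ) :
    1 ≤ N * ZLattice.covolume (rankOneLattice N z) := by
  have := discreteTopology_rankOneLattice hN z
  have := isZLattice_rankOneLattice (N := N) (z := z)
  have hpos : 0 < ZLattice.covolume (rankOneLattice N z) :=
    ZLattice.covolume_pos (rankOneLattice N z)
  have hle : span ℤ (Set.range (EuclideanSpace.basisFun (Fin d) ℝ).toBasis) ≤
      rankOneLattice N z := by
    rw [OrthonormalBasis.coe_toBasis]
    exact le_sup_right
  have hratio := ZLattice.covolume_div_covolume_eq_relIndex' _ _ hle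
  rw [OrthonormalBasis.coe_toBasis, covolume_span_orthonormalBasis] at hratio
  rw [← div_le_iff₀ hpos, hratio]
  exact_mod_cast Nat.le_of_dvd hN (relIndex_rankOneLattice_dvd hN z)

theorem rankOneLattice_ne_bot (hd : 0 < d) (N : ℕ) (z : Fin d → ℕ) : rankOneLattice N z ≠ ⊥ :=
  (Submodule.ne_bot_iff _).2 ⟨_, basisFun_mem_rankOneLattice N z ⟨0, hd⟩, by simp⟩

theorem dualLattice_rankOneLattice_ne_bot (hd : 0 < d) (hN : 0 < N) (z : Fin d → ℕ) :
    dualLattice (rankOneLattice N z) ≠ ⊥ := by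
  refine (Submodule.ne_bot_iff _).2 ⟨EuclideanSpace.single ⟨0, hd⟩ (N : ℝ), fun x hx => ?_, ?_⟩
  · obtain ⟨k, hk⟩ := mem_span_basisFun_iff.1 (natCast_smul_mem_span_basisFun hN hx) ⟨0, hd⟩
    exact ⟨k, by simpa [EuclideanSpace.inner_single_right] using hk⟩
  · simpa using hN.ne'

theorem exists_int_of_mem_dualLattice (hN : 0 < N) {y : EuclideanSpace ℝ (Fin d)}
    (hy : y ∈ dualLattice (rankOneLattice N z)) :
    ∃ h : Fin d → ℤ, (∀ j, y j = h j) ∧ (N : ℤ) ∣ ∑ j, h j * z j := by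
  have hN' : (N : ℝ) ≠ 0 := by exact_mod_cast hN.ne'
  have hcoord : ∀ j, ∃ k : ℤ, y j = k := fun j => by
    obtain ⟨k, hk⟩ := hy _ (basisFun_mem_rankOneLattice N z j)
    exact ⟨k, by simpa [EuclideanSpace.inner_single_left] using hk⟩
  choose h hh using hcoord
  obtain ⟨k, hk⟩ := hy (WithLp.toLp 2 (fun j => (z j : ℝ) / (N : ℝ)))
    (mem_sup_left (mem_span_singleton_self _))
  refine ⟨h, hh, k, ?_⟩
  have hsum : ∑ j, y j * (z j / N) = k := by
    simpa [PiLp.inner_apply] using hk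
  have : (∑ j, (h j : ℝ) * z j) = N * k := by
    rw [← hsum, Finset.mul_sum]
    refine Finset.sum_congr rfl fun j _ => ?_
    rw [hh]
    field_simp
  exact_mod_cast this

end RankOneLattice

section RankOnePointSet

open Submodule

variable {d N : ℕ} {z : Fin d → ℕ} {x : EuclideanSpace ℝ (Fin d)}

theorem norm_le_sqrt_mul_of_abs_le {s : ℝ} (hs : 0 ≤ s) (h : ∀ j, |x j| ≤ s) :
    ‖x‖ ≤ √d * s := by
  rw [EuclideanSpace.norm_eq]
  refine Real.sqrt_le_iff.2 ⟨by positivity, ?_⟩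
  calc ∑ j, ‖x j‖ ^ 2 ≤ ∑ _j : Fin d, s ^ 2 := by
        gcongr with j
        exact h j
    _ = (√d * s) ^ 2 := by simp [mul_pow]

theorem rankOnePointSet_subset_unitCube (N : ℕ) (z : Fin d → ℕ) :
    rankOnePointSet N z ⊆ unitCube d := by
  rintro x ⟨n, -, h⟩ j
  rw [h j]
  exact ⟨Int.fract_nonneg _, (Int.fract_lt_one _).le⟩

theorem zero_mem_rankOnePointSet (hN : 0 < N) (z : Fin d → ℕ) : 0 ∈ rankOnePointSet N z :=
  ⟨0, hN, fun j => by simp⟩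

theorem rankOnePointSet_subset_rankOneLattice (N : ℕ) (z : Fin d → ℕ) :
    rankOnePointSet N z ⊆ rankOneLattice N z := by
  rintro x ⟨n, -, h⟩
  refine mem_rankOneLattice_iff.2 ⟨n, fun j => ⟨-⌊(n : ℝ) * (z j : ℝ) / (N : ℝ)⌋, ?_⟩⟩
  rw [h j, Int.fract]
  push_cast
  ring

theorem mem_rankOnePointSet_of_mem_rankOneLattice (hN : 0 < N) (hx : x ∈ rankOneLattice N z)
    (h01 : ∀ j, x j ∈ Set.Ico (0 : ℝ) 1) : x ∈ rankOnePointSet N z := by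
  obtain ⟨n, h⟩ := mem_rankOneLattice_iff.1 hx
  have hN' : (N : ℝ) ≠ 0 := by exact_mod_cast hN.ne'
  have hNz : (0 : ℤ) < N := by exact_mod_cast hN
  obtain ⟨m, hm⟩ := Int.eq_ofNat_of_zero_le (Int.emod_nonneg n hNz.ne')
  refine ⟨m, by have := Int.emod_lt_of_pos n hNz; omega, fun j => ?_⟩
  obtain ⟨k, hk⟩ := h j
  rw [← Int.fract_eq_self.2 (h01 j), Int.fract_eq_fract]
  have hn : (n : ℝ) = N * (n / N : ℤ) + m := by
    exact_mod_cast (hm ▸ (Int.mul_ediv_add_emod n N).symm)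
  refine ⟨k + z j * (n / N), ?_⟩
  rw [hk, hn]
  push_cast
  field_simp
  ring

theorem ncard_rankOnePointSet {j₀ : Fin d} (hz : z j₀ = 1) : (rankOnePointSet N z).ncard = N := by
  let point (n : ℕ) : EuclideanSpace ℝ (Fin d) :=
    WithLp.toLp 2 fun j => Int.fract ((n : ℝ) * (z j : ℝ) / (N : ℝ))
  have himage : rankOnePointSet N z = point '' Set.Iio N := by
    ext x
    exact exists_congr fun n => and_congr_right fun _ =>
      ⟨fun h => PiLp.ext fun j => (h j).symm, fun h j => by rw [← h]⟩
  have hpoint : ∀ n ∈ Set.Iio N, point n j₀ = n / N := by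
    intro n hn
    have hn' : (n : ℝ) < N := by exact_mod_cast hn
    change Int.fract ((n : ℝ) * (z j₀ : ℝ) / (N : ℝ)) = n / N
    rw [hz, Nat.cast_one, mul_one, Int.fract_eq_self]
    exact ⟨by positivity, (div_lt_one ((Nat.cast_nonneg n).trans_lt hn')).2 hn'⟩
  have hinj : Set.InjOn point (Set.Iio N) := by
    intro n hn m hm h
    have hN' : (N : ℝ) ≠ 0 := by exact_mod_cast (Nat.zero_le n).trans_lt hn |>.ne'
    have hcoord := congrArg (fun x : EuclideanSpace ℝ (Fin d) => x j₀) h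
    simp only [hpoint n hn, hpoint m hm, div_left_inj' hN', Nat.cast_inj] at hcoord
    exact hcoord
  rw [himage, hinj.ncard_image, ← Finset.coe_range, Set.ncard_coe_finset, Finset.card_range]

-- Points close to the boundary are first moved inside, to distance at least `2μ` from it, so that
-- a lattice point within `μ` lies in the half-open cube.
theorem exists_mem_rankOnePointSet_norm_sub_le {μ : ℝ} (hμ : 0 < μ) (hμ4 : μ < 1 / 4) (hN : 0 < N)
    (hcov : ∀ t, ∃ y ∈ rankOneLattice N z, ‖t - y‖ ≤ μ) (hx : x ∈ unitCube d) :
    ∃ y ∈ rankOnePointSet N z, ‖x - y‖ ≤ (2 * √d + 1) * μ := by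
  set x' : EuclideanSpace ℝ (Fin d) :=
    WithLp.toLp 2 (fun j => 2 * μ + (1 - 4 * μ) * x j)
  obtain ⟨y, hy, hxy⟩ := hcov x'
  refine ⟨y, mem_rankOnePointSet_of_mem_rankOneLattice hN hy fun j => ?_, ?_⟩
  · have hj : |2 * μ + (1 - 4 * μ) * x j - y j| ≤ μ := (PiLp.norm_apply_le (x' - y) j).trans hxy
    obtain ⟨h0, h1⟩ := hx j
    rw [abs_le] at hj
    constructor <;> nlinarith
  · have hxx' : ‖x - x'‖ ≤ √d * (2 * μ) := by
      refine norm_le_sqrt_mul_of_abs_le (by positivity) fun j => ?_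
      change |x j - (2 * μ + (1 - 4 * μ) * x j)| ≤ 2 * μ
      obtain ⟨h0, h1⟩ := hx j
      rw [abs_le]
      constructor <;> nlinarith
    calc ‖x - y‖ ≤ ‖x - x'‖ + ‖x' - y‖ := norm_sub_le_norm_sub_add_norm_sub _ _ _
      _ ≤ √d * (2 * μ) + μ := add_le_add hxx' hxy
      _ = (2 * √d + 1) * μ := by ring

theorem coveringRadius_rankOnePointSet_le {μ : ℝ} (hμ : 0 < μ) (hN : 0 < N)
    (hcov : ∀ t, ∃ y ∈ rankOneLattice N z, ‖t - y‖ ≤ μ) :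
    coveringRadius (rankOnePointSet N z) ≤ (4 * √d + 1) * μ := by
  have hzero := zero_mem_rankOnePointSet hN z
  refine csSup_le ⟨_, 0, rankOnePointSet_subset_unitCube N z hzero, rfl⟩ ?_
  rintro _ ⟨x, hx, rfl⟩
  rcases le_or_gt (1 / 4) μ with h4 | h4
  · calc Metric.infDist x _ ≤ dist x 0 := Metric.infDist_le_dist_of_mem hzero
      _ = ‖x‖ := dist_zero_right x
      _ ≤ √d * 1 := norm_le_sqrt_mul_of_abs_le zero_le_one fun j => by
          rw [abs_of_nonneg (hx j).1]; exact (hx j).2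
      _ ≤ √d * (4 * μ) := by gcongr; linarith
      _ ≤ (4 * √d + 1) * μ := by linarith
  · obtain ⟨y, hy, hxy⟩ := exists_mem_rankOnePointSet_norm_sub_le hμ h4 hN hcov hx
    calc Metric.infDist x _ ≤ dist x y := Metric.infDist_le_dist_of_mem hy
      _ ≤ (2 * √d + 1) * μ := by rwa [dist_eq_norm]
      _ ≤ (4 * √d + 1) * μ := by gcongr; norm_num

theorem successiveMinimum_one_le_infsep (hnt : (rankOnePointSet N z).Nontrivial) :
    successiveMinimum (rankOneLattice N z) 1 ≤ (rankOnePointSet N z).infsep := by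
  refine hnt.le_infsep fun x hx y hy hxy => ?_
  rw [dist_eq_norm]
  exact successiveMinimum_one_le (sub_mem (rankOnePointSet_subset_rankOneLattice N z hx)
    (rankOnePointSet_subset_rankOneLattice N z hy)) (sub_ne_zero.2 hxy)

theorem exists_mem_rankOneLattice_norm_sub_le (hN : 0 < N)
    (hdual : 0 < successiveMinimum (dualLattice (rankOneLattice N z)) 1)
    (t : EuclideanSpace ℝ (Fin d)) :
    ∃ y ∈ rankOneLattice N z,
      ‖t - y‖ ≤ 2 ^ d / successiveMinimum (dualLattice (rankOneLattice N z)) 1 := by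
  have := discreteTopology_rankOneLattice hN z
  have := isZLattice_rankOneLattice (N := N) (z := z)
  exact exists_mem_norm_sub_le hdual (fun _ => successiveMinimum_one_le) t

theorem meshRatio_rankOnePointSet_le (hnt : (rankOnePointSet N z).Nontrivial)
    (hprimal : 0 < successiveMinimum (rankOneLattice N z) 1)
    (hdual : 0 < successiveMinimum (dualLattice (rankOneLattice N z)) 1) :
    meshRatio (rankOnePointSet N z) ≤ 2 ^ (d + 1) * (4 * √d + 1) /
      (successiveMinimum (rankOneLattice N z) 1 *
        successiveMinimum (dualLattice (rankOneLattice N z)) 1) := by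
  have hN : 0 < N := by
    obtain ⟨x, n, hn, -⟩ := hnt.nonempty
    omega
  set m := successiveMinimum (rankOneLattice N z) 1
  set m' := successiveMinimum (dualLattice (rankOneLattice N z)) 1
  have hcov : coveringRadius (rankOnePointSet N z) ≤ (4 * √d + 1) * (2 ^ d / m') :=
    coveringRadius_rankOnePointSet_le (by positivity) hN
      (exists_mem_rankOneLattice_norm_sub_le hN hdual)
  calc meshRatio (rankOnePointSet N z) ≤ (4 * √d + 1) * (2 ^ d / m') / (m / 2) := by
        unfold meshRatio separationRadius
        gcongr
        exact successiveMinimum_one_le_infsep hnt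
    _ = 2 ^ (d + 1) * (4 * √d + 1) / (m * m') := by field_simp; ring

end RankOnePointSet

section GoodParameter

variable {d N : ℕ}

open Polynomial in
theorem exists_ne_zero_forall_sum_mul_pow_ne_zero {R : Type*} [CommRing R] [IsDomain R] [Fintype R]
    {H : Finset (Fin d → R)} (h0 : 0 ∉ H) (hcard : H.card * d < Fintype.card R - 1) :
    ∃ α : R, α ≠ 0 ∧ ∀ h ∈ H, ∑ j, h j * α ^ (j : ℕ) ≠ 0 := by
  classical
  have hp0 : ∀ h ∈ H, ofFn d h ≠ 0 := fun h hh hp =>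
    h0 (injective_ofFn d (hp.trans (ofFn_zero d).symm) ▸ hh)
  have hdeg : ∀ h : Fin d → R, (ofFn d h).natDegree ≤ d := fun h =>
    natDegree_le_of_degree_le (ofFn_degree_lt h).le
  have hroots : (H.biUnion fun h => (ofFn d h).roots.toFinset).card ≤ H.card * d :=
    Finset.card_biUnion_le_card_mul _ _ _ fun h _ =>
      (Multiset.toFinset_card_le _).trans ((card_roots' _).trans (hdeg h))
  obtain ⟨α, hα, hαroots⟩ := Finset.exists_mem_notMem_of_card_lt_card
    (t := Finset.univ.erase (0 : R)) (hroots.trans_lt (by simpa using hcard))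
  refine ⟨α, Finset.ne_of_mem_erase hα, fun h hh hsum => hαroots ?_⟩
  refine Finset.mem_biUnion.2 ⟨h, hh, Multiset.mem_toFinset.2 ((mem_roots (hp0 h hh)).2 ?_)⟩
  simpa [ofFn_eq_sum_monomial, eval_finsetSum] using hsum

theorem exists_lt_abs_of_dvd_sum_korobovVector (hd : 0 < d) (hN : N.Prime) {T : ℕ}
    (hT : ((2 * T + 1) ^ d - 1) * d < N - 1) :
    ∃ a ∈ Finset.Icc 1 (N - 1), ∀ h : Fin d → ℤ, h ≠ 0 →
      (N : ℤ) ∣ ∑ j, h j * (korobovVector d N a j : ℤ) → ∃ j, (T : ℤ) < |h j| := by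
  classical
  have : Fact N.Prime := ⟨hN⟩
  have hTN : T < N := by
    have hpow := Nat.le_self_pow hd.ne' (2 * T + 1)
    have hmul := Nat.le_mul_of_pos_right ((2 * T + 1) ^ d - 1) hd
    omega
  let box : Finset (Fin d → ℤ) := Fintype.piFinset fun _ => Finset.Icc (-(T : ℤ)) T
  have hbox : ∀ {h}, h ∈ box ↔ ∀ j, |h j| ≤ T := by simp [box, abs_le]
  have hcard : (box.erase 0).card = (2 * T + 1) ^ d - 1 := by
    rw [Finset.card_erase_of_mem (hbox.2 (by simp)), Fintype.card_piFinset_const, Int.card_Icc]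
    congr 2
    omega
  let reduction (h : Fin d → ℤ) : Fin d → ZMod N := fun j => h j
  have hreduction : 0 ∉ (box.erase 0).image reduction := by
    intro h
    obtain ⟨h, hh, hh0⟩ := Finset.mem_image.1 h
    refine Finset.ne_of_mem_erase hh (funext fun j => ?_)
    exact Int.eq_zero_of_abs_lt_dvd ((ZMod.intCast_zmod_eq_zero_iff_dvd _ _).1 (congrFun hh0 j))
      ((hbox.1 (Finset.mem_of_mem_erase hh) j).trans_lt (by exact_mod_cast hTN))
  obtain ⟨α, hα0, hα⟩ := exists_ne_zero_forall_sum_mul_pow_ne_zero hreduction <| by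
    rw [ZMod.card]
    exact (Nat.mul_le_mul_right d (Finset.card_image_le.trans hcard.le)).trans_lt hT
  refine ⟨α.val, ?_, fun h h0 hdvd => ?_⟩
  · have hlt := ZMod.val_lt α
    have hne : α.val ≠ 0 := by rwa [Ne, ZMod.val_eq_zero]
    rw [Finset.mem_Icc]
    omega
  · by_contra! hsmall
    refine hα _ (Finset.mem_image_of_mem reduction (Finset.mem_erase.2 ⟨h0, hbox.2 hsmall⟩)) ?_
    simpa [korobovVector] using (ZMod.intCast_zmod_eq_zero_iff_dvd _ N).2 hdvd

theorem exists_pow_lt_and_le_mul_pow (hd : 0 < d) (hN : 1 < N) :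
    ∃ T : ℕ, ((2 * T + 1) ^ d - 1) * d < N - 1 ∧ N ≤ d * (3 * (T + 1)) ^ d := by
  have hexists : ∃ T : ℕ, N ≤ d * (3 * (T + 1)) ^ d := by
    refine ⟨N, ?_⟩
    have hpow := Nat.le_self_pow hd.ne' (3 * (N + 1))
    have hmul := Nat.le_mul_of_pos_left ((3 * (N + 1)) ^ d) hd
    omega
  classical
  refine ⟨Nat.find hexists, ?_, Nat.find_spec hexists⟩
  rcases hT : Nat.find hexists with - | T
  · simpa using hN
  · have hlt : d * (3 * (T + 1)) ^ d < N :=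
      not_le.1 (Nat.find_min hexists (hT ▸ Nat.lt_succ_self T))
    have hle : d * (2 * (T + 1) + 1) ^ d ≤ d * (3 * (T + 1)) ^ d := by gcongr; omega
    rw [Nat.sub_one_mul, mul_comm]
    omega

theorem add_one_le_successiveMinimum_dualLattice_korobovLattice (hd : 0 < d) (hN : 0 < N)
    {a T : ℕ} (h : ∀ h : Fin d → ℤ, h ≠ 0 →
      (N : ℤ) ∣ ∑ j, h j * (korobovVector d N a j : ℤ) → ∃ j, (T : ℤ) < |h j|) :
    (T + 1 : ℝ) ≤ successiveMinimum (dualLattice (korobovLattice d N a)) 1 := by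
  refine le_successiveMinimum_one (dualLattice_rankOneLattice_ne_bot hd hN _) fun y hy hy0 => ?_
  obtain ⟨k, hk, hdvd⟩ := exists_int_of_mem_dualLattice hN hy
  obtain ⟨j, hj⟩ := h k (fun hk0 => hy0 (PiLp.ext fun j => by simp [hk, hk0])) hdvd
  calc (T + 1 : ℝ) ≤ |(k j : ℝ)| := by exact_mod_cast Int.add_one_le_iff.2 hj
    _ = ‖y j‖ := by rw [hk, Real.norm_eq_abs]
    _ ≤ ‖y‖ := PiLp.norm_apply_le y j

theorem exists_le_mul_successiveMinimum_dualLattice_pow (hd : 0 < d) (hN : N.Prime) :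
    ∃ a ∈ Finset.Icc 1 (N - 1),
      (N : ℝ) ≤ d * (3 * successiveMinimum (dualLattice (korobovLattice d N a)) 1) ^ d := by
  obtain ⟨T, hT, hNT⟩ := exists_pow_lt_and_le_mul_pow hd hN.one_lt
  obtain ⟨a, ha, h⟩ := exists_lt_abs_of_dvd_sum_korobovVector hd hN hT
  refine ⟨a, ha, ?_⟩
  calc (N : ℝ) ≤ d * (3 * (T + 1)) ^ d := by exact_mod_cast hNT
    _ ≤ _ := by
      gcongr
      exact add_one_le_successiveMinimum_dualLattice_korobovLattice hd hN.pos h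

theorem successiveMinimum_dualLattice_pow_le (hd : 0 < d) (hN : 0 < N) (z : Fin d → ℕ)
    (hdual : 0 < successiveMinimum (dualLattice (rankOneLattice N z)) 1) :
    successiveMinimum (dualLattice (rankOneLattice N z)) 1 ^ (d - 1) ≤
      N * successiveMinimum (rankOneLattice N z) 1 * 2 ^ ((d + 1) * (d - 1)) := by
  have := discreteTopology_rankOneLattice hN z
  have := isZLattice_rankOneLattice (N := N) (z := z)
  set m' := successiveMinimum (dualLattice (rankOneLattice N z)) 1
  have : (0 : ℝ) < N := by exact_mod_cast hN
  suffices m' ^ (d - 1) / (N * 2 ^ ((d + 1) * (d - 1))) ≤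
      successiveMinimum (rankOneLattice N z) 1 by
    rw [div_le_iff₀ (by positivity)] at this
    linarith
  refine le_successiveMinimum_one (rankOneLattice_ne_bot hd N z) fun v hv hv0 => ?_
  rw [div_le_iff₀ (by positivity)]
  have hcov := covolume_le_norm_mul_pow hv hv0 (exists_mem_rankOneLattice_norm_sub_le hN hdual)
  rw [finrank_euclideanSpace_fin] at hcov
  calc m' ^ (d - 1) ≤ m' ^ (d - 1) * (N * ZLattice.covolume (rankOneLattice N z)) :=
        le_mul_of_one_le_right (by positivity) (one_le_mul_covolume_rankOneLattice hN z)
    _ ≤ m' ^ (d - 1) * (N * (‖v‖ * (2 * (2 ^ d / m')) ^ (d - 1))) := by gcongr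
    _ = ‖v‖ * (N * 2 ^ ((d + 1) * (d - 1))) := by
      rw [pow_mul, show 2 * (2 ^ d / m') = 2 ^ (d + 1) / m' by ring, div_pow]
      field_simp

theorem exists_one_le_mul_exactScore (hd : 0 < d) (hN : N.Prime) :
    ∃ a ∈ Finset.Icc 1 (N - 1),
      1 ≤ d * 3 ^ d * 2 ^ ((d + 1) * (d - 1)) * exactScore d N a := by
  obtain ⟨a, ha, hNa⟩ := exists_le_mul_successiveMinimum_dualLattice_pow hd hN
  refine ⟨a, ha, ?_⟩
  have hN' : (0 : ℝ) < N := by exact_mod_cast hN.pos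
  have hdual : 0 < successiveMinimum (dualLattice (korobovLattice d N a)) 1 := by
    refine (successiveMinimum_nonneg _ 1).lt_of_ne fun h => hNa.not_gt ?_
    simpa [← h, hd.ne'] using hN.pos
  have hpow := successiveMinimum_dualLattice_pow_le hd hN.pos _ hdual
  refine le_of_mul_le_mul_left ?_ hN'
  set m' := successiveMinimum (dualLattice (korobovLattice d N a)) 1
  calc N * 1 ≤ d * 3 ^ d * (m' ^ (d - 1) * m') := by
        rwa [mul_one, pow_sub_one_mul hd.ne', mul_assoc, ← mul_pow]
    _ ≤ d * 3 ^ d * (N * successiveMinimum (korobovLattice d N a) 1 *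
          2 ^ ((d + 1) * (d - 1)) * m') := by gcongr; exact hpow
    _ = N * (d * 3 ^ d * 2 ^ ((d + 1) * (d - 1)) * exactScore d N a) := by
      rw [exactScore]
      ring

end GoodParameter

section Search

variable {score : ℕ → ℝ}

theorem fst_le_searchStep (score : ℕ → ℝ) (s : ℝ × ℕ) (a : ℕ) : s.1 ≤ (searchStep score s a).1 := by
  unfold searchStep
  split_ifs with h
  exacts [h.le, le_rfl]

theorem score_le_searchStep (score : ℕ → ℝ) (s : ℝ × ℕ) (a : ℕ) :
    score a ≤ (searchStep score s a).1 := by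
  unfold searchStep
  split_ifs with h
  exacts [le_rfl, not_lt.1 h]

theorem searchStep_eq_or_eq (score : ℕ → ℝ) (s : ℝ × ℕ) (a : ℕ) :
    searchStep score s a = s ∨ searchStep score s a = (score a, a) := by
  unfold searchStep
  split_ifs
  exacts [Or.inr rfl, Or.inl rfl]

theorem fst_le_foldl_searchStep (score : ℕ → ℝ) (l : List ℕ) (s : ℝ × ℕ) :
    s.1 ≤ (l.foldl (searchStep score) s).1 := by
  induction l generalizing s with
  | nil => exact le_rfl
  | cons a l ih => exact (fst_le_searchStep score s a).trans (ih _)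

theorem score_le_foldl_searchStep {l : List ℕ} {a : ℕ} (ha : a ∈ l) (s : ℝ × ℕ) :
    score a ≤ (l.foldl (searchStep score) s).1 := by
  induction l generalizing s with
  | nil => simp at ha
  | cons b l ih =>
    rcases List.mem_cons.1 ha with rfl | ha
    · exact (score_le_searchStep score s a).trans (fst_le_foldl_searchStep score l _)
    · exact ih ha _

theorem foldl_searchStep_eq_or_exists (score : ℕ → ℝ) (l : List ℕ) (s : ℝ × ℕ) :
    l.foldl (searchStep score) s = s ∨ ∃ a ∈ l, l.foldl (searchStep score) s = (score a, a) := by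
  induction l generalizing s with
  | nil => exact Or.inl rfl
  | cons b l ih =>
    rw [List.foldl_cons]
    rcases ih (searchStep score s b) with h | ⟨a, ha, h⟩
    · rw [h]
      exact (searchStep_eq_or_eq score s b).imp_right fun h => ⟨b, List.mem_cons_self, h⟩
    · exact Or.inr ⟨a, List.mem_cons_of_mem b ha, h⟩

theorem mem_range'_one_sub_one_iff {a N : ℕ} :
    a ∈ List.range' 1 (N - 1) ↔ a ∈ Finset.Icc 1 (N - 1) := by
  rw [List.mem_range'_1, Finset.mem_Icc]
  omega

theorem exhaustiveSearch_mem (score : ℕ → ℝ) {N : ℕ} (hN : 2 ≤ N) :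
    exhaustiveSearch score N ∈ Finset.Icc 1 (N - 1) := by
  rw [exhaustiveSearch]
  rcases foldl_searchStep_eq_or_exists score (List.range' 1 (N - 1)) (0, 1) with h | ⟨a, ha, h⟩
  · rw [h, Finset.mem_Icc]
    omega
  · rw [h]
    exact mem_range'_one_sub_one_iff.1 ha

theorem le_score_exhaustiveSearch {N : ℕ} (hpos : ∃ b ∈ Finset.Icc 1 (N - 1), 0 < score b)
    {a : ℕ} (ha : a ∈ Finset.Icc 1 (N - 1)) : score a ≤ score (exhaustiveSearch score N) := by
  have hmax : ∀ b ∈ Finset.Icc 1 (N - 1),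
      score b ≤ ((List.range' 1 (N - 1)).foldl (searchStep score) (0, 1)).1 := fun b hb =>
    score_le_foldl_searchStep (mem_range'_one_sub_one_iff.2 hb) _
  rw [exhaustiveSearch]
  rcases foldl_searchStep_eq_or_exists score (List.range' 1 (N - 1)) (0, 1) with h | ⟨c, -, h⟩
  · obtain ⟨b, hb, hb0⟩ := hpos
    exact absurd (hmax b hb) (by rw [h]; exact hb0.not_ge)
  · rw [h] at hmax ⊢
    exact hmax a ha

end Search

section GramSchmidt

open InnerProductSpace

variable {E ι : Type*} [NormedAddCommGroup E] [InnerProductSpace ℝ E] [LinearOrder ι]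
  [LocallyFiniteOrderBot ι] [WellFoundedLT ι]

theorem gramSchmidt_of_isMin (b : ι → E) {k : ι} (hk : IsMin k) : gramSchmidt ℝ b k = b k := by
  rw [gramSchmidt_def, Finset.Iio_eq_empty.2 hk, Finset.sum_empty, sub_zero]

theorem inner_gramSchmidt_apply_self (b : ι → E) (k : ι) :
    inner ℝ (gramSchmidt ℝ b k) (b k) = ‖gramSchmidt ℝ b k‖ ^ 2 := by
  conv_lhs => rw [gramSchmidt_def'' ℝ b k]
  rw [inner_add_right, real_inner_self_eq_norm_sq, inner_sum, Finset.sum_eq_zero, add_zero]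
  intro i hi
  rw [inner_smul_right, gramSchmidt_orthogonal ℝ b (Finset.mem_Iio.1 hi).ne', mul_zero]

theorem inner_gramSchmidt_linearCombination {b : ι → E} {c : ι →₀ ℤ} {k : ι}
    (hk : ∀ i, k < i → c i = 0) :
    inner ℝ (gramSchmidt ℝ b k) (c.sum fun i a => a • b i) = c k * ‖gramSchmidt ℝ b k‖ ^ 2 := by
  simp only [← Int.cast_smul_eq_zsmul ℝ]
  rw [Finsupp.sum, inner_sum, Finset.sum_eq_single k, real_inner_smul_right,
    inner_gramSchmidt_apply_self]
  · intro i _ hik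
    rw [real_inner_smul_right]
    rcases lt_or_gt_of_ne hik with h | h
    · rw [gramSchmidt_inv_triangular ℝ b h, mul_zero]
    · rw [hk i h, Int.cast_zero, zero_mul]
  · intro h
    rw [Finsupp.notMem_support_iff.1 h, Int.cast_zero, zero_smul, inner_zero_right]

theorem exists_norm_gramSchmidt_le_norm {b : ι → E} (hb : LinearIndependent ℝ b) {x : E}
    (hx : x ∈ Submodule.span ℤ (Set.range b)) (h0 : x ≠ 0) : ∃ k, ‖gramSchmidt ℝ b k‖ ≤ ‖x‖ := by
  obtain ⟨c, rfl⟩ := Finsupp.mem_span_range_iff_exists_finsupp.1 hx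
  have hc : c.support.Nonempty :=
    Finsupp.support_nonempty_iff.2 fun hc => h0 (by rw [hc, Finsupp.sum_zero_index])
  set k := c.support.max' hc
  have hck : c k ≠ 0 := Finsupp.mem_support_iff.1 (Finset.max'_mem _ hc)
  have hgt : ∀ i, k < i → c i = 0 := fun i hi =>
    Finsupp.notMem_support_iff.1 fun h => (Finset.le_max' _ i h).not_gt hi
  have hpos : 0 < ‖gramSchmidt ℝ b k‖ := norm_pos_iff.2 (gramSchmidt_ne_zero k hb)
  refine ⟨k, le_of_mul_le_mul_left ?_ hpos⟩
  calc ‖gramSchmidt ℝ b k‖ * ‖gramSchmidt ℝ b k‖ = 1 * ‖gramSchmidt ℝ b k‖ ^ 2 := by ring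
    _ ≤ |(c k : ℝ)| * ‖gramSchmidt ℝ b k‖ ^ 2 := by
        gcongr
        exact_mod_cast Int.one_le_abs hck
    _ = |inner ℝ (gramSchmidt ℝ b k) (c.sum fun i a => a • b i)| := by
        rw [inner_gramSchmidt_linearCombination hgt, abs_mul, abs_of_nonneg (sq_nonneg ‖_‖)]
    _ ≤ _ := abs_real_inner_le_norm _ _

end GramSchmidt

section LLL

open InnerProductSpace

variable {d : ℕ} {δ : ℝ} {b : Fin d → EuclideanSpace ℝ (Fin d)}
  {L : Submodule ℤ (EuclideanSpace ℝ (Fin d))}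

/-- The largest factor by which the length of a Gram–Schmidt vector of a basis that is LLL-reduced
with parameter `δ` can exceed the length of the next one, namely `(δ - 1 / 4) ^ (-1 / 2)`. It is
replaced by `1` when it is smaller, so that its powers are monotone in the exponent. -/
def lllFactor (δ : ℝ) : ℝ :=
  √(max 1 (δ - 1 / 4)⁻¹)

theorem one_le_lllFactor (δ : ℝ) : 1 ≤ lllFactor δ :=
  Real.one_le_sqrt.2 (le_max_left _ _)

theorem IsLLLReduced.norm_gramSchmidt_le (hδ : 1 / 4 < δ) (hb : IsLLLReduced δ b) {k l : Fin d}
    (hkl : (l : ℕ) + 1 = k) :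
    ‖gramSchmidt ℝ b l‖ ≤ lllFactor δ * ‖gramSchmidt ℝ b k‖ := by
  have hδ' : 0 < δ - 1 / 4 := sub_pos.2 hδ
  have hμ : gramSchmidtCoeff b k l ^ 2 ≤ 1 / 4 := by
    have := sq_le_sq.2 ((hb.size_reduced k l (by simp [Fin.lt_def, ← hkl])).trans (le_abs_self _))
    norm_num at this ⊢
    exact this
  have hlovasz : (δ - 1 / 4) * ‖gramSchmidt ℝ b l‖ ^ 2 ≤ ‖gramSchmidt ℝ b k‖ ^ 2 := by
    have := mul_le_mul_of_nonneg_right hμ (sq_nonneg ‖gramSchmidt ℝ b l‖)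
    linarith [hb.lovasz k l hkl]
  refine le_of_sq_le_sq ?_ (by unfold lllFactor; positivity)
  rw [mul_pow, lllFactor, Real.sq_sqrt (by positivity)]
  calc ‖gramSchmidt ℝ b l‖ ^ 2 ≤ (δ - 1 / 4)⁻¹ * ‖gramSchmidt ℝ b k‖ ^ 2 := by
        rwa [inv_mul_eq_div, le_div_iff₀' hδ']
    _ ≤ max 1 (δ - 1 / 4)⁻¹ * ‖gramSchmidt ℝ b k‖ ^ 2 := by
        gcongr
        exact le_max_right _ _

theorem IsLLLReduced.norm_zero_le (hδ : 1 / 4 < δ) (hb : IsLLLReduced δ b) (k : Fin d) :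
    ‖b ⟨0, k.pos⟩‖ ≤ lllFactor δ ^ d * ‖gramSchmidt ℝ b k‖ := by
  have hle : ∀ (n : ℕ) (hn : n < d),
      ‖b ⟨0, k.pos⟩‖ ≤ lllFactor δ ^ n * ‖gramSchmidt ℝ b ⟨n, hn⟩‖ := by
    intro n
    induction n with
    | zero =>
      intro hn
      rw [pow_zero, one_mul, gramSchmidt_of_isMin b fun l _ => Nat.zero_le l]
    | succ n ih =>
      intro hn
      calc ‖b ⟨0, k.pos⟩‖ ≤ lllFactor δ ^ n * ‖gramSchmidt ℝ b ⟨n, by omega⟩‖ := ih _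
        _ ≤ lllFactor δ ^ n * (lllFactor δ * ‖gramSchmidt ℝ b ⟨n + 1, hn⟩‖) := by
          gcongr
          · exact pow_nonneg (zero_le_one.trans (one_le_lllFactor δ)) n
          · exact hb.norm_gramSchmidt_le hδ rfl
        _ = lllFactor δ ^ (n + 1) * ‖gramSchmidt ℝ b ⟨n + 1, hn⟩‖ := by ring
  refine (hle k k.2).trans ?_
  gcongr
  exacts [one_le_lllFactor δ, k.2.le]

theorem successiveMinimum_one_le_shortestLength (hd : 0 < d) (hL : IsLatticeBasis L b) :
    successiveMinimum L 1 ≤ shortestLength b := by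
  have : Nonempty (Fin d) := ⟨⟨0, hd⟩⟩
  exact le_ciInf fun j =>
    successiveMinimum_one_le (hL.2 ▸ Submodule.subset_span ⟨j, rfl⟩) (hL.1.ne_zero j)

theorem shortestLength_le_mul_successiveMinimum_one (hd : 0 < d) (hδ : 1 / 4 < δ)
    (hL : IsLatticeBasis L b) (hb : IsLLLReduced δ b) :
    shortestLength b ≤ lllFactor δ ^ d * successiveMinimum L 1 := by
  have hpos : 0 < lllFactor δ ^ d := pow_pos (zero_lt_one.trans_le (one_le_lllFactor δ)) d
  have hmem : b ⟨0, hd⟩ ∈ L := hL.2 ▸ Submodule.subset_span ⟨_, rfl⟩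
  rw [← div_le_iff₀' hpos]
  refine le_successiveMinimum_one
    ((Submodule.ne_bot_iff _).2 ⟨_, hmem, hL.1.ne_zero _⟩) fun x hx h0 => ?_
  rw [div_le_iff₀' hpos]
  obtain ⟨k, hk⟩ := exists_norm_gramSchmidt_le_norm hL.1 (hL.2 ▸ hx) h0
  calc shortestLength b ≤ ‖b ⟨0, hd⟩‖ :=
        ciInf_le ⟨0, Set.forall_mem_range.2 fun j => norm_nonneg (b j)⟩ _
    _ ≤ lllFactor δ ^ d * ‖gramSchmidt ℝ b k‖ := hb.norm_zero_le hδ k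
    _ ≤ lllFactor δ ^ d * ‖x‖ := by gcongr

end LLL

section QuasiUniform

variable {d N : ℕ}

theorem ncard_korobovPointSet (hd : 0 < d) (hN : 1 < N) (a : ℕ) :
    (korobovPointSet d N a).ncard = N := by
  refine ncard_rankOnePointSet (j₀ := ⟨0, hd⟩) ?_
  rw [korobovVector, pow_zero, Nat.mod_eq_of_lt hN]

theorem meshRatio_korobovPointSet_le (hd : 0 < d) (hN : 1 < N) {a : ℕ} {C : ℝ}
    (hC : 1 ≤ C * exactScore d N a) :
    meshRatio (korobovPointSet d N a) ≤ 2 ^ (d + 1) * (4 * √d + 1) * C := by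
  have hnonneg := successiveMinimum_nonneg (korobovLattice d N a) 1
  have hnonneg' := successiveMinimum_nonneg (dualLattice (korobovLattice d N a)) 1
  have hscore : exactScore d N a ≠ 0 := fun h => by
    rw [h, mul_zero] at hC
    exact absurd hC (by norm_num)
  obtain ⟨hne, hne'⟩ := mul_ne_zero_iff.1 hscore
  have hpos : 0 < exactScore d N a := (mul_nonneg hnonneg hnonneg').lt_of_ne' hscore
  have hnt : (korobovPointSet d N a).Nontrivial := by
    refine (Set.one_lt_ncard_iff_nontrivial_and_finite.1 ?_).1
    rwa [ncard_korobovPointSet hd hN]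
  calc meshRatio (korobovPointSet d N a)
      ≤ 2 ^ (d + 1) * (4 * √d + 1) / exactScore d N a :=
        meshRatio_rankOnePointSet_le hnt (hnonneg.lt_of_ne' hne) (hnonneg'.lt_of_ne' hne')
    _ ≤ 2 ^ (d + 1) * (4 * √d + 1) * C := by
        rw [div_le_iff₀ hpos, mul_assoc _ C]
        exact le_mul_of_one_le_right (by positivity) hC

theorem exists_exactScore_pos (hd : 0 < d) (hN : N.Prime) :
    ∃ a ∈ Finset.Icc 1 (N - 1), 0 < exactScore d N a := by
  obtain ⟨a, ha, h⟩ := exists_one_le_mul_exactScore hd hN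
  exact ⟨a, ha, pos_of_mul_pos_right (zero_lt_one.trans_le h) (by positivity)⟩

theorem one_le_mul_exactScore_exhaustiveSearch (hd : 0 < d) (hN : N.Prime) {score : ℕ → ℝ} {A : ℝ}
    (hle : ∀ b ∈ Finset.Icc 1 (N - 1), exactScore d N b ≤ score b)
    (hA : ∀ b ∈ Finset.Icc 1 (N - 1), score b ≤ A * exactScore d N b) :
    1 ≤ d * 3 ^ d * 2 ^ ((d + 1) * (d - 1)) * A * exactScore d N (exhaustiveSearch score N) := by
  obtain ⟨b, hb, hbscore⟩ := exists_one_le_mul_exactScore hd hN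
  obtain ⟨c, hc, hcscore⟩ := exists_exactScore_pos hd hN
  rw [mul_assoc _ A]
  refine hbscore.trans (mul_le_mul_of_nonneg_left ?_ (by positivity))
  calc exactScore d N b ≤ score b := hle b hb
    _ ≤ score (exhaustiveSearch score N) :=
        le_score_exhaustiveSearch ⟨c, hc, hcscore.trans_le (hle c hc)⟩ hb
    _ ≤ A * exactScore d N (exhaustiveSearch score N) :=
        hA _ (exhaustiveSearch_mem score hN.two_le)

theorem isQuasiUniformFamily_exhaustiveSearch (hd : 0 < d) {N : ℕ → ℕ} (hN : ∀ i, (N i).Prime)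
    (hlt : ∀ i, N i < N (i + 1)) (hgrowth : ∃ c : ℝ, 1 < c ∧ ∀ i, (N (i + 1) : ℝ) ≤ c * N i)
    {score : ℕ → ℕ → ℝ} {A : ℝ}
    (hle : ∀ i, ∀ b ∈ Finset.Icc 1 (N i - 1), exactScore d (N i) b ≤ score i b)
    (hA : ∀ i, ∀ b ∈ Finset.Icc 1 (N i - 1), score i b ≤ A * exactScore d (N i) b) :
    IsQuasiUniformFamily N
      (fun i => korobovPointSet d (N i) (exhaustiveSearch (score i) (N i))) where
  subset_unitCube i := rankOnePointSet_subset_unitCube _ _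
  two_le i := (hN i).two_le
  card_eq i := ncard_korobovPointSet hd (hN i).one_lt _
  strictMono := hlt
  growth := hgrowth
  meshRatio_le := by
    refine ⟨max 1 (2 ^ (d + 1) * (4 * √d + 1) * (d * 3 ^ d * 2 ^ ((d + 1) * (d - 1)) * A)),
      by positivity, fun i => le_max_of_le_right ?_⟩
    exact meshRatio_korobovPointSet_le hd (hN i).one_lt
      (one_le_mul_exactScore_exhaustiveSearch hd (hN i) (hle i) (hA i))

end QuasiUniform

section LLLScore

variable {d N a : ℕ} {δ : ℝ} {B B' : Fin d → EuclideanSpace ℝ (Fin d)}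

theorem exactScore_le_shortestLength_mul (hd : 0 < d)
    (hB : IsLatticeBasis (korobovLattice d N a) B)
    (hB' : IsLatticeBasis (dualLattice (korobovLattice d N a)) B') :
    exactScore d N a ≤ shortestLength B * shortestLength B' :=
  mul_le_mul (successiveMinimum_one_le_shortestLength hd hB)
    (successiveMinimum_one_le_shortestLength hd hB') (successiveMinimum_nonneg _ 1)
    (Real.iInf_nonneg fun j => norm_nonneg (B j))

theorem shortestLength_mul_le_mul_exactScore (hd : 0 < d) (hδ : 1 / 4 < δ)
    (hB : IsLatticeBasis (korobovLattice d N a) B ∧ IsLLLReduced δ B)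
    (hB' : IsLatticeBasis (dualLattice (korobovLattice d N a)) B' ∧ IsLLLReduced δ B') :
    shortestLength B * shortestLength B' ≤ (lllFactor δ ^ d) ^ 2 * exactScore d N a :=
  calc shortestLength B * shortestLength B'
      ≤ lllFactor δ ^ d * successiveMinimum (korobovLattice d N a) 1 *
          (lllFactor δ ^ d * successiveMinimum (dualLattice (korobovLattice d N a)) 1) :=
        mul_le_mul_of_nonneg
          (shortestLength_le_mul_successiveMinimum_one hd hδ hB.1 hB.2)
          (shortestLength_le_mul_successiveMinimum_one hd hδ hB'.1 hB'.2)
          (Real.iInf_nonneg fun j => norm_nonneg (B j))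
          (mul_nonneg (pow_nonneg (zero_le_one.trans (one_le_lllFactor δ)) d)
            (successiveMinimum_nonneg _ 1))
    _ = (lllFactor δ ^ d) ^ 2 * exactScore d N a := by rw [exactScore]; ring

end LLLScore

theorem nth_prime_succ_le_two_mul (i : ℕ) :
    Nat.nth Nat.Prime (i + 1) ≤ 2 * Nat.nth Nat.Prime i := by
  obtain ⟨p, hp, hlt, hle⟩ := Nat.exists_prime_lt_and_le_two_mul (Nat.nth Nat.Prime i)
    (Nat.prime_nth_prime i).ne_zero
  refine le_trans (not_lt.1 fun h => ?_) hle
  exact (Nat.le_nth_of_lt_nth_succ h hp).not_gt hlt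

theorem theorem3p3_general {d : ℕ} (hd : 0 < d) {N : ℕ → ℕ} (hN : ∀ i, (N i).Prime)
    (hlt : ∀ i, N i < N (i + 1)) (hgrowth : ∃ c : ℝ, 1 < c ∧ ∀ i, (N (i + 1) : ℝ) ≤ c * N i) :
    (∀ a : ℕ → ℕ, (∀ i, a i = exhaustiveSearch (exactScore d (N i)) (N i)) →
      (∀ i, a i ∈ Finset.Icc 1 (N i - 1) ∧
        ∀ b ∈ Finset.Icc 1 (N i - 1), exactScore d (N i) b ≤ exactScore d (N i) (a i)) ∧
      IsQuasiUniformFamily N (fun i => korobovPointSet d (N i) (a i))) ∧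
    (∀ δ : ℝ, 1 / 4 < δ → ∀ B B' : ℕ → ℕ → Fin d → EuclideanSpace ℝ (Fin d),
      (∀ i, ∀ b ∈ Finset.Icc 1 (N i - 1),
        (IsLatticeBasis (korobovLattice d (N i) b) (B i b) ∧ IsLLLReduced δ (B i b)) ∧
        (IsLatticeBasis (dualLattice (korobovLattice d (N i) b)) (B' i b) ∧
          IsLLLReduced δ (B' i b))) →
      ∀ a : ℕ → ℕ,
      (∀ i, a i =
        exhaustiveSearch (fun b => shortestLength (B i b) * shortestLength (B' i b)) (N i)) →
      (∀ i, a i ∈ Finset.Icc 1 (N i - 1)) ∧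
      IsQuasiUniformFamily N (fun i => korobovPointSet d (N i) (a i))) := by
  refine ⟨fun a ha => ?_, fun δ hδ B B' hB a ha => ?_⟩ <;> obtain rfl := funext ha
  · refine ⟨fun i => ⟨exhaustiveSearch_mem _ (hN i).two_le, fun b hb =>
      le_score_exhaustiveSearch (exists_exactScore_pos hd (hN i)) hb⟩, ?_⟩
    exact isQuasiUniformFamily_exhaustiveSearch hd hN hlt hgrowth (A := 1) (fun _ _ _ => le_rfl)
      fun _ _ _ => (one_mul _).ge
  · refine ⟨fun i => exhaustiveSearch_mem _ (hN i).two_le, ?_⟩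
    exact isQuasiUniformFamily_exhaustiveSearch hd hN hlt hgrowth
      (fun i b hb => exactScore_le_shortestLength_mul hd (hB i b hb).1.1 (hB i b hb).2.1)
      fun i b hb => shortestLength_mul_le_mul_exactScore hd hδ (hB i b hb).1 (hB i b hb).2

end

theorem theorem3p3 (d : ℕ) (hd : 1 ≤ d) :
    -- the search with the exact score `λ₁(Λ_a) λ₁(Λ_a^⊥)`
    (∀ a : ℕ → ℕ,
      (∀ i, a i = exhaustiveSearch (exactScore d (Nat.nth Nat.Prime i)) (Nat.nth Nat.Prime i)) →
      (∀ i, a i ∈ Finset.Icc 1 (Nat.nth Nat.Prime i - 1) ∧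
        ∀ b ∈ Finset.Icc 1 (Nat.nth Nat.Prime i - 1),
          exactScore d (Nat.nth Nat.Prime i) b ≤ exactScore d (Nat.nth Nat.Prime i) (a i)) ∧
      IsQuasiUniformFamily (fun i => Nat.nth Nat.Prime i)
        (fun i => korobovPointSet d (Nat.nth Nat.Prime i) (a i))) ∧
    -- the search with the score computed from LLL-reduced bases `B i b` of `Λ_b` and
    -- `B' i b` of `Λ_b^⊥`, whichever reduced bases the reduction returns
    (∀ δ : ℝ, 1 / 4 < δ → δ < 1 →
      ∀ B B' : ℕ → ℕ → Fin d → EuclideanSpace ℝ (Fin d),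
      (∀ i, ∀ b ∈ Finset.Icc 1 (Nat.nth Nat.Prime i - 1),
        (IsLatticeBasis (korobovLattice d (Nat.nth Nat.Prime i) b) (B i b) ∧
          IsLLLReduced δ (B i b)) ∧
        (IsLatticeBasis (dualLattice (korobovLattice d (Nat.nth Nat.Prime i) b)) (B' i b) ∧
          IsLLLReduced δ (B' i b))) →
      ∀ a : ℕ → ℕ,
      (∀ i, a i = exhaustiveSearch (fun b => shortestLength (B i b) * shortestLength (B' i b))
        (Nat.nth Nat.Prime i)) →
      (∀ i, a i ∈ Finset.Icc 1 (Nat.nth Nat.Prime i - 1)) ∧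
      IsQuasiUniformFamily (fun i => Nat.nth Nat.Prime i)
        (fun i => korobovPointSet d (Nat.nth Nat.Prime i) (a i))) := by
  obtain ⟨hexact, hlll⟩ := theorem3p3_general hd Nat.prime_nth_prime
    (fun i => Nat.nth_strictMono Nat.infinite_setOfPred_prime i.lt_succ_self)
    ⟨2, one_lt_two, fun i => by exact_mod_cast nth_prime_succ_le_two_mul i⟩
  exact ⟨hexact, fun δ hδ _ => hlll δ hδ⟩
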